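/- Let $G$ be a group with a finite generating set $A$ such that the Cayley graph $\mathrm{Cay}(G,A)$ is $\delta$-hyperbolic (geodesic triangles are $\delta$-slim: each side lies in the $\delta$-neighborhood of the union of the other two), and let $H\le G$ be a $\kappa$-quasiconvex subgroup (every geodesic of $\mathrm{Cay}(G,A)$ with endpoints in $H$ lies in the $\kappa$-neighborhood of $H$). Then: 1. $H$ has finite height in $G$: there is a finite maximal number of distinct cosets $g_iH$ for which the intersection $\bigcap_i g_iHg_i^{-1}$ is infinite. 2. $H$ has bounded packing in $G$: for every proper left-invariant metric $d$ on $G$ (for example, any word metric with respect to a finite generating set; proper means that all balls are finite) and every constant $D$ there is a number $N$ such that among any $N$ distinct left cosets of $H$ in $G$ at least two are separated by a $d$-distance of at least $D$, where the distance between two subsets is the infimum of the distances between their points. 3. $H$ has finite width in $G$: there is a finite maximal number of distinct cosets $g_iH$ such that for all $i,j$ (including $i=j$) the intersection $g_iHg_i^{-1}\cap g_jHg_j^{-1}$ is infinite. -/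

import Mathlib

namespace BoundedPacking

/-- A walk in a graph is a geodesic if its length is the distance between its endpoints. -/
def IsGeodesic {V : Type*} {Γ : SimpleGraph V} {u v : V} (p : Γ.Walk u v) : Prop :=
  p.length = Γ.dist u v

/-- All geodesic triangles (with corners at vertices) of the graph `Γ` are `δ`-slim: each vertex on
the side `p` is at distance at most `δ` from a vertex on one of the other two sides `q`, `r`.
The corners and the sides are arbitrary, so the condition applies to each of the three sides.
For a connected graph, this holds for some `δ` if and only if the geometric realization
(where edges have length one) is a hyperbolic geodesic metric space. -/
def IsSlimGraph {V : Type*} (Γ : SimpleGraph V) (δ : ℝ) : Prop :=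
  ∀ (x y z : V) (p : Γ.Walk x y) (q : Γ.Walk y z) (r : Γ.Walk x z),
    IsGeodesic p → IsGeodesic q → IsGeodesic r →
      ∀ v ∈ p.support, ∃ w, (w ∈ q.support ∨ w ∈ r.support) ∧ (Γ.dist v w : ℝ) ≤ δ

/-- `G` is a `δ`-hyperbolic group with respect to `A`: the set `A` is a finite generating set
of `G` and the Cayley graph of `G` with respect to `A` has `δ`-slim geodesic triangles. -/
structure IsHyperbolicGroup {G : Type*} [Group G] (A : Set G) (δ : ℝ) : Prop where
  finite : A.Finite
  closure_eq_top : Subgroup.closure A = ⊤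
  slim : IsSlimGraph (SimpleGraph.mulCayley A) δ

/-- `H` is `κ`-quasiconvex in `G` with respect to `A`: each geodesic in the Cayley graph joining
two points of `H` lies in the `κ`-neighborhood of `H`. -/
def IsQuasiconvexSubgroup {G : Type*} [Group G] (A : Set G) (κ : ℝ) (H : Subgroup G) : Prop :=
  ∀ x ∈ H, ∀ y ∈ H, ∀ p : (SimpleGraph.mulCayley A).Walk x y, IsGeodesic p →
    ∀ v ∈ p.support, ∃ h ∈ H, ((SimpleGraph.mulCayley A).dist v h : ℝ) ≤ κ

/-- The left coset `gH`, as a subset of `G`. -/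
def leftCoset {G : Type*} [Group G] (g : G) (H : Subgroup G) : Set G :=
  {x | ∃ h ∈ H, x = g * h}

/-- The conjugate subgroup `gHg⁻¹`. -/
def conjugate {G : Type*} [Group G] (g : G) (H : Subgroup G) : Subgroup G :=
  H.map (MulAut.conj g).toMonoidHom

/-- The cosets `g i H` are pairwise distinct. -/
def DistinctCosets {G : Type*} [Group G] (H : Subgroup G) {n : ℕ} (g : Fin n → G) : Prop :=
  Function.Injective fun i => leftCoset (g i) H

/-- The distance between two subsets: the infimum of the distances between their points. -/
noncomputable def setDist {X : Type*} (d : MetricSpace X) (Y Z : Set X) : ℝ :=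
  sInf {r | ∃ y ∈ Y, ∃ z ∈ Z, r = d.dist y z}

/-- A metric on a group is left invariant and proper (every metric ball is finite). -/
structure IsProperLeftInvariant {G : Type*} [Group G] (d : MetricSpace G) : Prop where
  dist_mul_left : ∀ g x y : G, d.dist (g * x) (g * y) = d.dist x y
  finite_ball : ∀ (x : G) (r : ℝ), {y : G | d.dist y x < r}.Finite

/-- Bounded packing with respect to a metric `d`: for each `D` there is `N` such that among any
`N` distinct cosets of `H`, at least two are separated by a distance of at least `D`. -/
def HasBoundedPackingWrt {G : Type*} [Group G] (d : MetricSpace G) (H : Subgroup G) : Prop :=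
  ∀ D : ℝ, ∃ N : ℕ, ∀ g : Fin N → G, DistinctCosets H g →
    ∃ i j, i ≠ j ∧ D ≤ setDist d (leftCoset (g i) H) (leftCoset (g j) H)

/-- Bounded packing of `H` in `G`, with respect to every proper left invariant metric on `G`.
(For finitely generated `G`, each word metric is such a metric.) -/
def HasBoundedPacking {G : Type*} [Group G] (H : Subgroup G) : Prop :=
  ∀ d : MetricSpace G, IsProperLeftInvariant d → HasBoundedPackingWrt d H

/-- The height of `H` in `G`: the maximal number of distinct cosets `g i H` such that the
intersection of all the conjugates `g i H (g i)⁻¹` is infinite, or `⊤` if there is no maximum. -/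
noncomputable def height {G : Type*} [Group G] (H : Subgroup G) : ℕ∞ :=
  sSup {m : ℕ∞ | ∃ n : ℕ, m = n ∧ ∃ g : Fin n → G, DistinctCosets H g ∧
    (⋂ i, (conjugate (g i) H : Set G)).Infinite}

/-- The width of `H` in `G`: the maximal number of distinct cosets `g i H` such that for all
`i, j` the intersection of `g i H (g i)⁻¹` and `g j H (g j)⁻¹` is infinite, or `⊤` if there is
no maximum. (With `i = j` allowed, a finite subgroup has width zero.) -/
noncomputable def width {G : Type*} [Group G] (H : Subgroup G) : ℕ∞ :=
  sSup {m : ℕ∞ | ∃ n : ℕ, m = n ∧ ∃ g : Fin n → G, DistinctCosets H g ∧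
    ∀ i j, ((conjugate (g i) H : Set G) ∩ (conjugate (g j) H : Set G)).Infinite}

end BoundedPacking

/-! Everything rests on a Helly property: pairwise close quasiconvex sets in a graph with slim
triangles are all close to one vertex (`exists_vertex_near_all`). Fix a basepoint, project it to
each set, and take the farthest projection. Applied to left cosets of `H`, which are uniformly
quasiconvex, this puts a point of each coset in one ball of fixed radius. Distinct cosets are
disjoint, so the size of the ball bounds their number (`exists_bound_of_pairwise_close`). Bounded
packing follows. For width, a long element common to two conjugates yields a geodesic whose middle
part is near both cosets, so the cosets are uniformly close (`exists_close_of_infinite_inter`).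
Height is at most width. -/

namespace BoundedPacking

/-! ### Quasiconvex sets in graphs with slim triangles -/

section Graph

variable {V : Type*} {Γ : SimpleGraph V}

/-- Every geodesic with endpoints in `Y` lies in the `K`-neighborhood of `Y`. -/
def IsQuasiconvexSet (Γ : SimpleGraph V) (K : ℕ) (Y : Set V) : Prop :=
  ∀ x ∈ Y, ∀ y ∈ Y, ∀ p : Γ.Walk x y, IsGeodesic p → ∀ v ∈ p.support, ∃ h ∈ Y, Γ.dist v h ≤ K

theorem IsGeodesic.reverse {u v : V} {p : Γ.Walk u v} (hp : IsGeodesic p) :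
    IsGeodesic p.reverse := by
  unfold IsGeodesic at *
  rw [SimpleGraph.Walk.length_reverse, hp, SimpleGraph.dist_comm]

theorem exists_isGeodesic (hΓ : Γ.Connected) (u v : V) : ∃ p : Γ.Walk u v, IsGeodesic p :=
  hΓ.exists_walk_length_eq_dist u v

theorem IsGeodesic.dist_add_dist (hΓ : Γ.Connected) {u v w : V} {p : Γ.Walk u v}
    (hp : IsGeodesic p) (hw : w ∈ p.support) : Γ.dist u w + Γ.dist w v = Γ.dist u v := by
  obtain ⟨q, r, rfl⟩ := SimpleGraph.Walk.mem_support_iff_exists_append.mp hw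
  have h : q.length + r.length = Γ.dist u v := by
    rw [← SimpleGraph.Walk.length_append]; exact hp
  have := SimpleGraph.dist_le q
  have := SimpleGraph.dist_le r
  have := hΓ.dist_triangle (u := u) (v := w) (w := v)
  omega

theorem IsGeodesic.exists_dist_eq (hΓ : Γ.Connected) {u v : V} {p : Γ.Walk u v}
    (hp : IsGeodesic p) {n : ℕ} (hn : n ≤ Γ.dist u v) :
    ∃ w ∈ p.support, Γ.dist u w = n ∧ Γ.dist w v = Γ.dist u v - n := by
  have hmem := p.getVert_mem_support n
  have h := hp.dist_add_dist hΓ hmem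
  have h1 := SimpleGraph.dist_le (p.take n)
  have h2 := SimpleGraph.dist_le (p.drop n)
  rw [SimpleGraph.Walk.take_length] at h1
  rw [SimpleGraph.Walk.drop_length] at h2
  have hl : p.length = Γ.dist u v := hp
  exact ⟨_, hmem, by omega, by omega⟩

/-- A walk whose vertices all satisfy `P` or `Q`, from a `P`-vertex to a `Q`-vertex, has two
vertices at distance at most one, the first satisfying `P` and the second satisfying `Q`. -/
theorem exists_transition {P Q : V → Prop} {u w : V} (p : Γ.Walk u w)
    (h : ∀ v ∈ p.support, P v ∨ Q v) (hu : P u) (hw : Q w) :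
    ∃ a b, b ∈ p.support ∧ Γ.dist a b ≤ 1 ∧ P a ∧ Q b := by
  induction p with
  | nil => exact ⟨_, _, by simp, by simp, hu, hw⟩
  | @cons u v w huv p ih =>
    by_cases hv : P v
    · obtain ⟨a, b, hb, hab⟩ := ih (fun x hx => h x (by simp [hx])) hv hw
      exact ⟨a, b, by simp [hb], hab⟩
    · refine ⟨u, v, by simp, (SimpleGraph.dist_eq_one_iff_adj.mpr huv).le, hu, ?_⟩
      exact (h v (by simp)).resolve_left hv

variable {δ K : ℕ}

theorem IsSlimGraph.exists_dist_le (hs : IsSlimGraph Γ (δ : ℝ)) {x y z v : V} {p : Γ.Walk x y}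
    {q : Γ.Walk y z} {r : Γ.Walk x z} (hp : IsGeodesic p) (hq : IsGeodesic q)
    (hr : IsGeodesic r) (hv : v ∈ p.support) :
    (∃ w ∈ q.support, Γ.dist v w ≤ δ) ∨ ∃ w ∈ r.support, Γ.dist v w ≤ δ := by
  obtain ⟨w, hw, h⟩ := hs x y z p q r hp hq hr v hv
  have h : Γ.dist v w ≤ δ := by exact_mod_cast h
  exact hw.imp (fun hw => ⟨w, hw, h⟩) fun hw => ⟨w, hw, h⟩

/-- A geodesic from `o` to a point of a quasiconvex set passes near a projection of `o`. -/
theorem IsQuasiconvexSet.exists_mem_near_projection (hΓ : Γ.Connected)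
    (hs : IsSlimGraph Γ (δ : ℝ)) {Y : Set V} (hY : IsQuasiconvexSet Γ K Y) {o π y : V}
    (hπ : π ∈ Y) (hmin : ∀ y' ∈ Y, Γ.dist o π ≤ Γ.dist o y') (hy : y ∈ Y) {c : Γ.Walk o y}
    (hc : IsGeodesic c) : ∃ w ∈ c.support, Γ.dist π w ≤ 3 * δ + K + 2 := by
  obtain ⟨a, ha⟩ := exists_isGeodesic hΓ o π
  obtain ⟨b, hb⟩ := exists_isGeodesic hΓ π y
  obtain ⟨v, v', hv', hvv', ⟨u, hu, hvu⟩, ⟨w, hw, hvw⟩⟩ := exists_transition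
    (P := fun v => ∃ u ∈ a.support, Γ.dist v u ≤ δ)
    (Q := fun v => ∃ w ∈ c.support, Γ.dist v w ≤ δ) b
    (fun v hv => by
      rcases hs.exists_dist_le hb hc.reverse ha.reverse hv with ⟨w, hw, h⟩ | ⟨w, hw, h⟩
      · exact Or.inr ⟨w, by simpa using hw, h⟩
      · exact Or.inl ⟨w, by simpa using hw, h⟩)
    ⟨π, by simp, by simp⟩ ⟨y, by simp, by simp⟩
  obtain ⟨h, hh, hvh⟩ := hY π hπ y hy b hb v' hv'
  refine ⟨w, hw, ?_⟩
  -- As `u` lies on a geodesic from `o` to its nearest point `π`, the distance from `u` to `π` is at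
  -- most that from `u` to `h`, hence at most `δ + 1 + K`. Passing on from `u` to `w` costs `2 * δ +
  -- 1` more.
  have := ha.dist_add_dist hΓ hu
  have := hmin h hh
  have := hΓ.dist_triangle (u := o) (v := u) (w := h)
  have := hΓ.dist_triangle (u := u) (v := v) (w := h)
  have := hΓ.dist_triangle (u := v) (v := v') (w := h)
  have := hΓ.dist_triangle (u := π) (v := u) (w := w)
  have := hΓ.dist_triangle (u := u) (v := v) (w := w)
  have := hΓ.dist_triangle (u := v) (v := v') (w := w)
  have := Γ.dist_comm (u := u) (v := v)
  have := Γ.dist_comm (u := u) (v := π)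
  omega

/-- If two quasiconvex sets are `D`-close, the projection of `o` that is farther from `o` is close
to the other set. -/
theorem IsQuasiconvexSet.projection_near_of_close (hΓ : Γ.Connected)
    (hs : IsSlimGraph Γ (δ : ℝ)) {Y Z : Set V} (hY : IsQuasiconvexSet Γ K Y)
    (hZ : IsQuasiconvexSet Γ K Z) {o π ρ y z : V} {D : ℕ}
    (hπ : π ∈ Y) (hmin : ∀ y' ∈ Y, Γ.dist o π ≤ Γ.dist o y') (hρ : ρ ∈ Z)
    (hle : Γ.dist o ρ ≤ Γ.dist o π) (hy : y ∈ Y) (hz : z ∈ Z) (hyz : Γ.dist y z ≤ D) :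
    ∃ x ∈ Z, Γ.dist π x ≤ 2 * (5 * δ + K + 2 + D) + K := by
  obtain ⟨c, hc⟩ := exists_isGeodesic hΓ o y
  obtain ⟨c', hc'⟩ := exists_isGeodesic hΓ o z
  obtain ⟨e, he⟩ := exists_isGeodesic hΓ y z
  obtain ⟨a, ha⟩ := exists_isGeodesic hΓ o ρ
  obtain ⟨b, hb⟩ := exists_isGeodesic hΓ z ρ
  obtain ⟨q, hq, hπq⟩ := hY.exists_mem_near_projection hΓ hs hπ hmin hy hc
  obtain ⟨s, hsc, hqs⟩ : ∃ s ∈ c'.support, Γ.dist q s ≤ δ + D := by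
    rcases hs.exists_dist_le hc he hc' hq with ⟨w, hw, h⟩ | ⟨w, hw, h⟩
    · refine ⟨z, by simp, ?_⟩
      have := he.dist_add_dist hΓ hw
      have := hΓ.dist_triangle (u := q) (v := w) (w := z)
      omega
    · exact ⟨w, hw, by omega⟩
  -- Now `π` is within `4 * δ + K + 2 + D` of `s`, hence within `E = 5 * δ + K + 2 + D` of `t`
  -- below.
  have h1 := hΓ.dist_triangle (u := π) (v := q) (w := s)
  rcases hs.exists_dist_le hc' hb ha hsc with ⟨t, ht, h⟩ | ⟨t, ht, h⟩
  · obtain ⟨x, hx, htx⟩ := hZ z hz ρ hρ b hb t ht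
    refine ⟨x, hx, ?_⟩
    have := hΓ.dist_triangle (u := π) (v := s) (w := x)
    have := hΓ.dist_triangle (u := s) (v := t) (w := x)
    omega
  · refine ⟨ρ, hρ, ?_⟩
    -- Since `ρ` is no farther from `o` than `π`, the distance from `t` to `ρ` is at most that from
    -- `t` to `π`; so `π` is within `2 * E` of `ρ`.
    have := ha.dist_add_dist hΓ ht
    have := hΓ.dist_triangle (u := π) (v := s) (w := t)
    have := hΓ.dist_triangle (u := π) (v := t) (w := ρ)
    have := hΓ.dist_triangle (u := o) (v := t) (w := π)
    have := Γ.dist_comm (u := t) (v := π)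
    omega

/-- Helly property: finitely many pairwise close quasiconvex sets in a graph with slim triangles
are all close to a common vertex. -/
theorem exists_vertex_near_all (hΓ : Γ.Connected) (hs : IsSlimGraph Γ (δ : ℝ)) {ι : Type*}
    [Finite ι] [Nonempty ι] {Y : ι → Set V} (hY : ∀ i, IsQuasiconvexSet Γ K (Y i))
    (hne : ∀ i, (Y i).Nonempty) {D : ℕ}
    (hclose : ∀ i j, i ≠ j → ∃ y ∈ Y i, ∃ z ∈ Y j, Γ.dist y z ≤ D) :
    ∃ v, ∀ i, ∃ x ∈ Y i, Γ.dist v x ≤ 2 * (5 * δ + K + 2 + D) + K := by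
  obtain ⟨o⟩ := hΓ.nonempty
  have hproj : ∀ i, ∃ π ∈ Y i, ∀ y ∈ Y i, Γ.dist o π ≤ Γ.dist o y := fun i => by
    obtain ⟨π, hπ, h⟩ :=
      (measure (fun y => Γ.dist o y)).wf.has_min (Y i) (hne i)
    exact ⟨π, hπ, fun y hy => not_lt.mp (h y hy)⟩
  choose π hπ hmin using hproj
  obtain ⟨i, hi⟩ := Finite.exists_max fun i => Γ.dist o (π i)
  refine ⟨π i, fun j => ?_⟩
  rcases eq_or_ne i j with rfl | hij
  · exact ⟨π i, hπ i, by simp⟩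
  · obtain ⟨y, hy, z, hz, hyz⟩ := hclose i j hij
    exact (hY i).projection_near_of_close hΓ hs (hY j) (hπ i) (hmin i) (hπ j) (hi j) hy hz hyz

/-- A point of a geodesic far from both ends is close to a quasiconvex set that contains points
comparatively near the two ends. -/
theorem IsQuasiconvexSet.exists_near_of_mem_geodesic (hΓ : Γ.Connected)
    (hs : IsSlimGraph Γ (δ : ℝ)) {Y : Set V} (hY : IsQuasiconvexSet Γ K Y) {a b u v m : V}
    {p : Γ.Walk a b} (hp : IsGeodesic p) (hm : m ∈ p.support) (hu : u ∈ Y) (hv : v ∈ Y)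
    (ham : Γ.dist a u + 2 * δ < Γ.dist a m) (hbm : Γ.dist b v + 2 * δ < Γ.dist m b) :
    ∃ y ∈ Y, Γ.dist m y ≤ 2 * δ + K := by
  obtain ⟨q, hq⟩ := exists_isGeodesic hΓ b v
  obtain ⟨r, hr⟩ := exists_isGeodesic hΓ a v
  obtain ⟨e, he⟩ := exists_isGeodesic hΓ v u
  obtain ⟨f, hf⟩ := exists_isGeodesic hΓ a u
  -- The diagonal `r` cuts the quadrilateral `a, u, v, b` into two slim triangles. The distance
  -- hypotheses keep `m` away from the sides `q` and `f`, leaving only `e`.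
  rcases hs.exists_dist_le hp hq hr hm with ⟨s, hs', h⟩ | ⟨s, hs', h⟩
  · have := hq.dist_add_dist hΓ hs'
    have := hΓ.dist_triangle (u := m) (v := s) (w := b)
    have := Γ.dist_comm (u := s) (v := b)
    omega
  rcases hs.exists_dist_le hr he hf hs' with ⟨t, ht, h'⟩ | ⟨t, ht, h'⟩
  · obtain ⟨y, hy, hty⟩ := hY v hv u hu e he t ht
    refine ⟨y, hy, ?_⟩
    have := hΓ.dist_triangle (u := m) (v := s) (w := y)
    have := hΓ.dist_triangle (u := s) (v := t) (w := y)
    omega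
  · have := hf.dist_add_dist hΓ ht
    have := hΓ.dist_triangle (u := a) (v := t) (w := m)
    have := hΓ.dist_triangle (u := t) (v := s) (w := m)
    have := Γ.dist_comm (u := s) (v := t)
    have := Γ.dist_comm (u := s) (v := m)
    omega

end Graph

/-! ### Cosets in the Cayley graph -/

section Cayley

variable {G : Type*} [Group G] {A : Set G}

/-- Left translation as an automorphism of the Cayley graph. -/
def mulCayleyTranslation (A : Set G) (g : G) :
    SimpleGraph.mulCayley A ≃g SimpleGraph.mulCayley A where
  toEquiv := Equiv.mulLeft g
  map_rel_iff' := SimpleGraph.mulCayley_adj_mul_iff_right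

theorem mulCayley_connected (hA : Subgroup.closure A = ⊤) :
    (SimpleGraph.mulCayley A).Connected := by
  have htrans : ∀ g x y : G, (SimpleGraph.mulCayley A).Reachable x y →
      (SimpleGraph.mulCayley A).Reachable (g * x) (g * y) := fun g x y h =>
    h.map (mulCayleyTranslation A g).toHom
  have hone : ∀ x : G, (SimpleGraph.mulCayley A).Reachable 1 x := fun x => by
    have hx : x ∈ Subgroup.closure A := hA ▸ Subgroup.mem_top x
    induction hx using Subgroup.closure_induction with
    | mem x hx =>
      by_cases h : (1 : G) = x
      · exact h ▸ SimpleGraph.Reachable.refl _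
      · exact ((SimpleGraph.mulCayley_adj A 1 x).mpr ⟨h, by simp [hx]⟩).reachable
    | one => exact SimpleGraph.Reachable.refl _
    | mul x y _ _ hx hy => exact hx.trans (by simpa using htrans x _ _ hy)
    | inv x _ hx => exact (by simpa using htrans x⁻¹ _ _ hx :
        (SimpleGraph.mulCayley A).Reachable x⁻¹ 1).symm
  exact ⟨fun x y => (hone x).symm.trans (hone y)⟩

theorem mulCayley_dist_mul_left (hA : Subgroup.closure A = ⊤) (g x y : G) :
    (SimpleGraph.mulCayley A).dist (g * x) (g * y) = (SimpleGraph.mulCayley A).dist x y := by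
  have hle : ∀ g x y : G, (SimpleGraph.mulCayley A).dist (g * x) (g * y) ≤
      (SimpleGraph.mulCayley A).dist x y := fun g x y => by
    obtain ⟨p, hp⟩ := exists_isGeodesic (mulCayley_connected hA) x y
    have h := SimpleGraph.dist_le (p.map (mulCayleyTranslation A g).toHom)
    rw [SimpleGraph.Walk.length_map, hp] at h
    exact h
  exact (hle g x y).antisymm (by simpa using hle g⁻¹ (g * x) (g * y))

theorem mulCayley_finite_ball (hf : A.Finite) (hA : Subgroup.closure A = ⊤) (n : ℕ) :
    {x : G | (SimpleGraph.mulCayley A).dist 1 x ≤ n}.Finite := by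
  induction n with
  | zero =>
    refine (Set.finite_singleton (1 : G)).subset fun x hx => ?_
    have hx : (SimpleGraph.mulCayley A).dist 1 x ≤ 0 := hx
    exact ((mulCayley_connected hA).dist_eq_zero_iff.mp (Nat.le_zero.mp hx)).symm
  | succ n ih =>
    refine (ih.union (Set.Finite.image2 (· * ·) ih (hf.union hf.inv))).subset fun x hx => ?_
    have hx : (SimpleGraph.mulCayley A).dist 1 x ≤ n + 1 := hx
    rcases Nat.lt_or_ge n ((SimpleGraph.mulCayley A).dist 1 x) with h | h
    · right
      obtain ⟨p, hp⟩ := exists_isGeodesic (mulCayley_connected hA) 1 x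
      obtain ⟨w, -, hw1, hw2⟩ := hp.exists_dist_eq (mulCayley_connected hA) h.le
      have hadj := SimpleGraph.dist_eq_one_iff_adj.mp (show _ = 1 from hw2.trans (by omega))
      obtain ⟨-, h' | h'⟩ := (SimpleGraph.mulCayley_adj A w x).mp hadj
      · exact ⟨w, hw1.le, w⁻¹ * x, Or.inl h', by simp⟩
      · exact ⟨w, hw1.le, w⁻¹ * x, Or.inr (by simpa using h'), by simp⟩
    · exact Or.inl h

theorem self_mem_leftCoset (g : G) (H : Subgroup G) : g ∈ leftCoset g H :=
  ⟨1, H.one_mem, by simp⟩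

theorem leftCoset_eq_of_mem {H : Subgroup G} {g g' x : G} (h : x ∈ leftCoset g H)
    (h' : x ∈ leftCoset g' H) : leftCoset g H = leftCoset g' H := by
  have key : ∀ {g : G}, x ∈ leftCoset g H → leftCoset g H = leftCoset x H := fun {g} h => by
    obtain ⟨k, hk, rfl⟩ := h
    ext y
    constructor
    · rintro ⟨l, hl, rfl⟩
      exact ⟨k⁻¹ * l, H.mul_mem (H.inv_mem hk) hl, by group⟩
    · rintro ⟨l, hl, rfl⟩
      exact ⟨k * l, H.mul_mem hk hl, by group⟩
  rw [key h, key h']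

/-- Translation by `g⁻¹` carries geodesics to geodesics, so the constant does not depend on `g`. -/
theorem IsQuasiconvexSubgroup.isQuasiconvexSet_leftCoset (hA : Subgroup.closure A = ⊤)
    {κ : ℝ} {K : ℕ} (hK : κ ≤ K) {H : Subgroup G} (hH : IsQuasiconvexSubgroup A κ H) (g : G) :
    IsQuasiconvexSet (SimpleGraph.mulCayley A) K (leftCoset g H) := by
  rintro _ ⟨x, hx, rfl⟩ _ ⟨y, hy, rfl⟩ p hp v hv
  let φ := (mulCayleyTranslation A g⁻¹).toHom
  have hφ : ∀ z, φ (g * z) = z := fun z => by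
    change g⁻¹ * (g * z) = z
    simp
  let p' : (SimpleGraph.mulCayley A).Walk x y := (p.map φ).copy (hφ x) (hφ y)
  have hp' : IsGeodesic p' := by
    unfold IsGeodesic at *
    rw [SimpleGraph.Walk.length_copy, SimpleGraph.Walk.length_map, hp,
      mulCayley_dist_mul_left hA]
  have hv' : g⁻¹ * v ∈ p'.support := by
    rw [SimpleGraph.Walk.support_copy, SimpleGraph.Walk.support_map]
    exact List.mem_map_of_mem (f := φ) hv
  obtain ⟨h, hh, hd⟩ := hH x hx y hy p' hp' _ hv'
  refine ⟨g * h, ⟨h, hh, rfl⟩, ?_⟩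
  rw [← mulCayley_dist_mul_left hA g] at hd
  have : ((SimpleGraph.mulCayley A).dist v (g * h) : ℝ) ≤ K := by
    simpa using hd.trans hK
  exact_mod_cast this

/-- The number of pairwise close distinct cosets of a quasiconvex subgroup of a hyperbolic group
is bounded. -/
theorem exists_bound_of_pairwise_close {δ κ : ℝ} (hG : IsHyperbolicGroup A δ)
    {H : Subgroup G} (hH : IsQuasiconvexSubgroup A κ H) (D : ℕ) :
    ∃ B : ℕ, ∀ (n : ℕ) (g : Fin n → G), DistinctCosets H g →
      (∀ i j, i ≠ j → ∃ y ∈ leftCoset (g i) H, ∃ z ∈ leftCoset (g j) H,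
        (SimpleGraph.mulCayley A).dist y z ≤ D) → n ≤ B := by
  have hA := hG.closure_eq_top
  have hs : IsSlimGraph (SimpleGraph.mulCayley A) (⌈δ⌉₊ : ℝ) :=
    fun x y z p q r hp hq hr v hv => by
      obtain ⟨w, hw, h⟩ := hG.slim x y z p q r hp hq hr v hv
      exact ⟨w, hw, h.trans (Nat.le_ceil δ)⟩
  set R := 2 * (5 * ⌈δ⌉₊ + ⌈κ⌉₊ + 2 + D) + ⌈κ⌉₊ with hR
  have hfin := mulCayley_finite_ball hG.finite hA R
  refine ⟨{x : G | (SimpleGraph.mulCayley A).dist 1 x ≤ R}.ncard, fun n g hg hclose => ?_⟩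
  rcases Nat.eq_zero_or_pos n with rfl | hn
  · exact Nat.zero_le _
  have : Nonempty (Fin n) := ⟨⟨0, hn⟩⟩
  obtain ⟨v, hv⟩ := exists_vertex_near_all (mulCayley_connected hA) hs
    (fun i => hH.isQuasiconvexSet_leftCoset hA (Nat.le_ceil κ) (g i))
    (fun i => ⟨_, self_mem_leftCoset (g i) H⟩) hclose
  choose x hx hvx using hv
  -- Translating `v` to `1` makes the bound independent of where the cosets meet the ball.
  have hinj : Function.Injective fun i => v⁻¹ * x i := fun i j hij => by
    have hij : x i = x j := mul_left_cancel hij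
    exact hg (leftCoset_eq_of_mem (hx i) (hij ▸ hx j))
  have hsub : Set.range (fun i => v⁻¹ * x i) ⊆
      {x : G | (SimpleGraph.mulCayley A).dist 1 x ≤ R} := by
    rintro _ ⟨i, rfl⟩
    have := hvx i
    rw [← mulCayley_dist_mul_left hA v⁻¹] at this
    simpa using this
  have h := Set.ncard_le_ncard hsub hfin
  rwa [← Nat.card_coe_set_eq, Nat.card_range_of_injective hinj, Nat.card_fin] at h

theorem hasBoundedPacking_of_isQuasiconvexSubgroup {δ κ : ℝ} (hG : IsHyperbolicGroup A δ)
    {H : Subgroup G} (hH : IsQuasiconvexSubgroup A κ H) : HasBoundedPacking H := by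
  intro d hd D
  -- By properness, word length is bounded on the `d`-ball of radius `D`, so by left invariance
  -- `d`-close points are also close in the Cayley graph.
  obtain ⟨C, hC⟩ := ((hd.finite_ball 1 D).image
    fun y => (SimpleGraph.mulCayley A).dist 1 y).bddAbove
  obtain ⟨B, hB⟩ := exists_bound_of_pairwise_close hG hH C
  refine ⟨B + 1, fun g hg => ?_⟩
  by_contra! hcon
  refine absurd (hB (B + 1) g hg fun i j hij => ?_) (by omega)
  have hne : {r | ∃ y ∈ leftCoset (g i) H, ∃ z ∈ leftCoset (g j) H, r = d.dist y z}.Nonempty :=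
    ⟨_, _, self_mem_leftCoset (g i) H, _, self_mem_leftCoset (g j) H, rfl⟩
  obtain ⟨_, ⟨y, hy, z, hz, rfl⟩, hlt⟩ := exists_lt_of_csInf_lt hne (hcon i j hij)
  refine ⟨y, hy, z, hz, ?_⟩
  rw [← mulCayley_dist_mul_left hG.closure_eq_top y⁻¹, inv_mul_cancel]
  refine hC ⟨y⁻¹ * z, ?_, rfl⟩
  change d.dist (y⁻¹ * z) 1 < D
  rw [← hd.dist_mul_left y, mul_inv_cancel_left, mul_one, d.dist_comm]
  exact hlt

/-- So the coset contains points as near to `x` as `g` is to `1`. -/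
theorem mul_mem_leftCoset_of_mem_conjugate {H : Subgroup G} {g x : G} (hx : x ∈ conjugate g H) :
    x * g ∈ leftCoset g H := by
  obtain ⟨k, hk, rfl⟩ := Subgroup.mem_map.mp hx
  exact ⟨k, hk, by simp⟩

/-- Cosets of a quasiconvex subgroup whose stabilizers have infinite intersection are uniformly
close. -/
theorem exists_close_of_infinite_inter {δ κ : ℝ} (hG : IsHyperbolicGroup A δ)
    {H : Subgroup G} (hH : IsQuasiconvexSubgroup A κ H) {g g' : G}
    (hinf : ((conjugate g H : Set G) ∩ (conjugate g' H : Set G)).Infinite) :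
    ∃ y ∈ leftCoset g H, ∃ z ∈ leftCoset g' H,
      (SimpleGraph.mulCayley A).dist y z ≤ 2 * (2 * ⌈δ⌉₊ + ⌈κ⌉₊) := by
  have hA := hG.closure_eq_top
  have hΓ := mulCayley_connected hA
  have hs : IsSlimGraph (SimpleGraph.mulCayley A) (⌈δ⌉₊ : ℝ) :=
    fun x y z p q r hp hq hr v hv => by
      obtain ⟨w, hw, h⟩ := hG.slim x y z p q r hp hq hr v hv
      exact ⟨w, hw, h.trans (Nat.le_ceil δ)⟩
  -- A vertex at distance `n` from `1` on a geodesic longer than `2 * n` is far enough from both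
  -- ends for `exists_near_of_mem_geodesic`, for `g` and `g'` at once.
  set n := (SimpleGraph.mulCayley A).dist 1 g + (SimpleGraph.mulCayley A).dist 1 g' +
    2 * ⌈δ⌉₊ + 1 with hn
  obtain ⟨h, ⟨hg, hg'⟩, hlong⟩ := hinf.exists_notMem_finite
    (mulCayley_finite_ball hG.finite hA (2 * n))
  have hlong : 2 * n < (SimpleGraph.mulCayley A).dist 1 h := not_le.mp hlong
  obtain ⟨p, hp⟩ := exists_isGeodesic hΓ 1 h
  obtain ⟨m, hm, hm1, hm2⟩ := hp.exists_dist_eq hΓ (n := n) (by omega)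
  have hdist : ∀ x, (SimpleGraph.mulCayley A).dist h (h * x) =
      (SimpleGraph.mulCayley A).dist 1 x := fun x => by
    simpa using mulCayley_dist_mul_left hA h 1 x
  obtain ⟨y, hy, hmy⟩ := (hH.isQuasiconvexSet_leftCoset hA (Nat.le_ceil κ)
    g).exists_near_of_mem_geodesic hΓ hs hp hm (self_mem_leftCoset g H)
    (mul_mem_leftCoset_of_mem_conjugate hg) (by omega) (by rw [hdist]; omega)
  obtain ⟨z, hz, hmz⟩ := (hH.isQuasiconvexSet_leftCoset hA (Nat.le_ceil κ)
    g').exists_near_of_mem_geodesic hΓ hs hp hm (self_mem_leftCoset g' H)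
    (mul_mem_leftCoset_of_mem_conjugate hg') (by omega) (by rw [hdist]; omega)
  refine ⟨y, hy, z, hz, ?_⟩
  have := hΓ.dist_triangle (u := y) (v := m) (w := z)
  have := (SimpleGraph.mulCayley A).dist_comm (u := y) (v := m)
  omega

theorem width_lt_top_of_isQuasiconvexSubgroup {δ κ : ℝ} (hG : IsHyperbolicGroup A δ)
    {H : Subgroup G} (hH : IsQuasiconvexSubgroup A κ H) : width H < ⊤ := by
  obtain ⟨B, hB⟩ := exists_bound_of_pairwise_close hG hH (2 * (2 * ⌈δ⌉₊ + ⌈κ⌉₊))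
  refine lt_of_le_of_lt (sSup_le ?_) (ENat.natCast_lt_top B)
  rintro _ ⟨n, rfl, g, hg, hinf⟩
  exact Nat.cast_le.mpr
    (hB n g hg fun i j _ => exists_close_of_infinite_inter hG hH (hinf i j))

/-- The common intersection lies in every pairwise one. -/
theorem height_le_width (H : Subgroup G) : height H ≤ width H := by
  refine sSup_le_sSup ?_
  rintro _ ⟨n, rfl, g, hg, hinf⟩
  exact ⟨n, rfl, g, hg, fun i j => hinf.mono (Set.subset_inter
    (Set.iInter_subset _ i) (Set.iInter_subset _ j))⟩

end Cayley

end BoundedPacking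

theorem mainTheorem7 {G : Type*} [Group G] (A : Set G) (δ κ : ℝ)
    (hG : BoundedPacking.IsHyperbolicGroup A δ) (H : Subgroup G)
    (hH : BoundedPacking.IsQuasiconvexSubgroup A κ H) :
    BoundedPacking.height H < ⊤ ∧
      BoundedPacking.HasBoundedPacking H ∧
      BoundedPacking.width H < ⊤ :=
  have hwidth := BoundedPacking.width_lt_top_of_isQuasiconvexSubgroup hG hH
  ⟨(BoundedPacking.height_le_width H).trans_lt hwidth,
    BoundedPacking.hasBoundedPacking_of_isQuasiconvexSubgroup hG hH, hwidth⟩
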